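/- Let $n\ge 1$ and let $A$ be a symmetric $n\times n$ matrix with rational entries whose support is connected, where the support of $A$ is the simple graph on $\{1,\dots,n\}$ in which $i\neq j$ are adjacent if and only if $A(i,j)\neq 0$. Let $D$ be a real diagonal $n\times n$ matrix with diagonal entries $x_1,\dots,x_n$ that are algebraically independent over $\mathbb{Q}$, i.e. the only polynomial $P\in\mathbb{Q}[X_1,\dots,X_n]$ with $P(x_1,\dots,x_n)=0$ is the zero polynomial. Then $(A,D)$ is a good pair: for all but finitely many $t\in\mathbb{R}$, every eigenvalue of the matrix $A+tD$ is simple, and every eigenvector of $A+tD$ has all of its entries nonzero. -/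

import Mathlib

namespace PerturbedPair

/-- The support of a real symmetric matrix `A`: the simple graph on the index set in which
distinct `i` and `j` are adjacent if and only if `A i j = A j i` is nonzero. -/
def supportGraph {n : ℕ} (A : Matrix (Fin n) (Fin n) ℝ) (hA : A.IsSymm) :
    SimpleGraph (Fin n) where
  Adj i j := i ≠ j ∧ A i j ≠ 0
  symm := ⟨fun i j h => ⟨h.1.symm, by rw [hA.apply i j]; exact h.2⟩⟩
  loopless := ⟨fun _ h => h.1 rfl⟩

/-- The one-parameter family `H_t(A, B) = A + t B`. -/
def family {n : ℕ} (A B : Matrix (Fin n) (Fin n) ℝ) (t : ℝ) : Matrix (Fin n) (Fin n) ℝ :=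
  A + t • B

/-- Every eigenvalue has a one-dimensional eigenspace. (For real symmetric matrices, the only ones
considered here, geometric and algebraic multiplicities agree.) -/
def HasSimpleEigenvalues {n : ℕ} (M : Matrix (Fin n) (Fin n) ℝ) : Prop :=
  ∀ μ : ℝ, Module.End.HasEigenvalue (Matrix.toLin' M) μ →
    Module.finrank ℝ (Module.End.eigenspace (Matrix.toLin' M) μ) = 1

/-- Every entry of every eigenvector is nonzero. -/
def HasNonvanishingEigenvectors {n : ℕ} (M : Matrix (Fin n) (Fin n) ℝ) : Prop :=
  ∀ (μ : ℝ) (φ : Fin n → ℝ), Module.End.HasEigenvector (Matrix.toLin' M) μ φ → ∀ i, φ i ≠ 0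

/-- `(A, B)` is a good pair of real symmetric matrices: for all but finitely many real `t`, the
matrix `A + t B` has simple eigenvalues and non-vanishing eigenvectors. -/
structure IsGoodPair {n : ℕ} (A B : Matrix (Fin n) (Fin n) ℝ) : Prop where
  symm_left : A.IsSymm
  symm_right : B.IsSymm
  finite_exceptions :
    {t : ℝ | ¬ (HasSimpleEigenvalues (family A B t) ∧
      HasNonvanishingEigenvectors (family A B t))}.Finite

end PerturbedPair

namespace PerturbedPair

open Matrix

/-! At `t = 1` no eigenvector vanishes anywhere, by counting transcendence degree: if one with
support `S` did, connectedness would make all `D k k`, `k ∈ S`, algebraic over `S.card - 1` numbers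
(`apply_ne_zero_of_mulVec_eq`). This makes the Krylov determinants nonzero at `t = 1`. They are
polynomials in `t`, so they vanish only finitely often, and elsewhere no eigenvector has a zero
entry. -/

/-- A set of algebraically independent elements, all of them algebraic over `R[t]`, has at most as
many elements as `t`. -/
lemma encard_le_encard_of_isAlgebraic_adjoin {R A : Type*} [CommRing R] [CommRing A] [IsDomain A]
    [Algebra R A] [FaithfulSMul R A] {s t : Set A} (hs : AlgebraicIndepOn R id s)
    (h : ∀ a ∈ s, IsAlgebraic (Algebra.adjoin R t) a) : s.encard ≤ t.encard := by
  have hind : (AlgebraicIndependent.matroid R A).Indep s := hs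
  have hsub : s ⊆ (AlgebraicIndependent.matroid R A).closure t := by
    intro a ha
    rw [AlgebraicIndependent.matroid_closure_eq]
    exact h a ha
  calc s.encard ≤ (AlgebraicIndependent.matroid R A).eRk
        ((AlgebraicIndependent.matroid R A).closure t) := hind.encard_le_eRk_of_subset hsub
    _ = (AlgebraicIndependent.matroid R A).eRk t := Matroid.eRk_closure_eq _ _
    _ ≤ t.encard := Matroid.eRk_le_encard _ _

/-- If `A` is rational with connected support and `D` is a diagonal matrix with algebraically
independent entries, then no eigenvector of `A + D` vanishes anywhere. -/
lemma apply_ne_zero_of_mulVec_eq {n : ℕ} {A D : Matrix (Fin n) (Fin n) ℝ}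
    (hA : A.IsSymm) (hrat : ∀ i j, ∃ q : ℚ, A i j = (q : ℝ))
    (hconn : (supportGraph A hA).Connected)
    (hdiag : D.IsDiag) (hD : AlgebraicIndependent ℚ (fun i => D i i))
    {μ : ℝ} {φ : Fin n → ℝ} (hφ : (A + D) *ᵥ φ = μ • φ) (hφ0 : φ ≠ 0) (i : Fin n) :
    φ i ≠ 0 := by
  intro hi
  obtain ⟨v, hv⟩ := Function.ne_iff.mp hφ0
  obtain ⟨p⟩ := hconn.preconnected v i
  obtain ⟨d, -, hd₁, hd₂⟩ := p.exists_boundary_dart {k | φ k ≠ 0} hv (by simpa using hi)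
  have hadj := d.adj
  set k₁ := d.fst
  set j := d.snd
  have hA1 : A j k₁ ≠ 0 := by rw [hA.apply]; exact hadj.2
  have hj : φ j = 0 := by simpa using hd₂
  have hk₁ : φ k₁ ≠ 0 := hd₁
  have heq : ∀ k, ∑ l, A k l * φ l + D k k * φ k = μ * φ k := by
    intro k
    have h := congrFun hφ k
    rw [add_mulVec, ← hdiag.diagonal_diag] at h
    simpa [mulVec, dotProduct, diagonal_apply] using h
  have hsum : ∑ l, A j l * φ l = 0 := by simpa [hj] using heq j
  -- A single nonzero term could not cancel in row `j`.
  obtain ⟨k₂, hk₂₁, hk₂⟩ : ∃ k, k ≠ k₁ ∧ φ k ≠ 0 := by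
    by_contra! hall
    rw [Finset.sum_eq_single k₁ (fun k _ hk => by rw [hall k hk, mul_zero]) (by simp)] at hsum
    exact mul_ne_zero hA1 hk₁ hsum
  let S : Finset (Fin n) := {k | φ k ≠ 0}
  let U : Finset (Fin n) := (S.erase k₁).erase k₂
  let ψ : Fin n → ℝ := fun k => φ k / φ k₂
  have hψ : ∀ k, ∑ l, A k l * ψ l + D k k * ψ k = μ * ψ k := by
    intro k
    have := congrArg (· / φ k₂) (heq k)
    simpa [ψ, add_div, Finset.sum_div, mul_div_assoc] using this
  have hψsum : ∑ l, A j l * ψ l = 0 := by simpa [ψ, hj] using hψ j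
  -- Scaling to `ψ k₂ = 1` and solving row `j` for `ψ k₁` removes two of the `S.card` unknown
  -- entries; `μ` adds one back.
  let T : Finset ℝ := insert μ (U.image ψ)
  let C := Subalgebra.algebraicClosure (Algebra.adjoin ℚ (T : Set ℝ)) ℝ
  have hT : ∀ a ∈ T, a ∈ C := fun a ha =>
    isAlgebraic_algebraMap (⟨a, Algebra.subset_adjoin ha⟩ : Algebra.adjoin ℚ (T : Set ℝ))
  have hAC : ∀ k l, A k l ∈ C := by
    intro k l
    obtain ⟨q, hq⟩ := hrat k l
    rw [hq]
    exact isAlgebraic_algebraMap (algebraMap ℚ (Algebra.adjoin ℚ (T : Set ℝ)) q)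
  have hdivC : ∀ a b, a ∈ C → b ∈ C → a / b ∈ C := fun a b ha hb => by
    rw [div_eq_mul_inv]
    exact C.mul_mem ha (IsAlgebraic.inv hb)
  have hψC' : ∀ k, k ≠ k₁ → ψ k ∈ C := by
    intro k hk
    by_cases hk2 : k = k₂
    · have : ψ k = 1 := by simp [ψ, hk2, hk₂]
      rw [this]
      exact C.one_mem
    by_cases hk0 : φ k = 0
    · have : ψ k = 0 := by simp [ψ, hk0]
      rw [this]
      exact C.zero_mem
    · have hkU : k ∈ U := by simp [U, S, hk, hk2, hk0]
      exact hT _ (Finset.mem_insert_of_mem (Finset.mem_image_of_mem _ hkU))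
  have hψC : ∀ k, ψ k ∈ C := by
    intro k
    by_cases hk : k = k₁
    · subst hk
      rw [← Finset.add_sum_erase _ _ (Finset.mem_univ k₁)] at hψsum
      have : ψ k₁ = (-∑ l ∈ Finset.univ.erase k₁, A j l * ψ l) / A j k₁ := by
        rw [eq_div_iff hA1]
        linarith
      rw [this]
      refine hdivC _ _ (C.neg_mem (C.sum_mem fun l hl => C.mul_mem (hAC _ _) (hψC' l ?_)))
        (hAC _ _)
      exact Finset.ne_of_mem_erase hl
    · exact hψC' k hk
  have hDC : ∀ k ∈ S, D k k ∈ C := by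
    intro k hk
    have hk0 : ψ k ≠ 0 := div_ne_zero (by simpa [S] using hk) hk₂
    have : D k k = μ - (∑ l, A k l * ψ l) / ψ k := by
      field_simp
      linarith [hψ k]
    rw [this]
    exact C.sub_mem (hT _ (Finset.mem_insert_self _ _))
      (hdivC _ _ (C.sum_mem fun l _ => C.mul_mem (hAC _ _) (hψC _)) (hψC _))
  have hcard := encard_le_encard_of_isAlgebraic_adjoin (R := ℚ)
    (s := (fun k => D k k) '' (S : Set (Fin n))) (t := (T : Set ℝ))
    (hD.coe_range.mono (Set.image_subset_range _ _))
    (by rintro _ ⟨k, hk, rfl⟩; exact hDC k hk)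
  rw [hD.injective.encard_image, Set.encard_coe_eq_coe_finsetCard,
    Set.encard_coe_eq_coe_finsetCard, Nat.cast_le] at hcard
  have hk₁S : k₁ ∈ S := by simpa [S] using hk₁
  have hk₂S : k₂ ∈ S.erase k₁ := by simp [S, hk₂, hk₂₁]
  have h1 := Finset.card_erase_add_one hk₁S
  have h2 := Finset.card_erase_add_one hk₂S
  have h3 : T.card ≤ U.card + 1 :=
    (Finset.card_insert_le _ _).trans (Nat.add_le_add_right Finset.card_image_le 1)
  have h4 : U.card = ((S.erase k₁).erase k₂).card := rfl
  omega

/-- The Krylov matrix of `M` at `i`: its `k`-th row is the `i`-th row of `M ^ k`. -/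
def krylov {R : Type*} [CommRing R] {n : ℕ} (M : Matrix (Fin n) (Fin n) R) (i : Fin n) :
    Matrix (Fin n) (Fin n) R :=
  of fun k l => (M ^ (k : ℕ)) i l

lemma pow_mulVec_of_mulVec_eq {R m : Type*} [CommRing R] [Fintype m] [DecidableEq m]
    {M : Matrix m m R} {μ : R} {φ : m → R} (hφ : M *ᵥ φ = μ • φ) (k : ℕ) :
    (M ^ k) *ᵥ φ = μ ^ k • φ := by
  induction k with
  | zero => simp
  | succ k ih => rw [pow_succ, ← mulVec_mulVec, hφ, mulVec_smul, ih, smul_smul, pow_succ']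

lemma krylov_mulVec_of_mulVec_eq {R : Type*} [CommRing R] {n : ℕ} {M : Matrix (Fin n) (Fin n) R}
    {μ : R} {φ : Fin n → R} (hφ : M *ᵥ φ = μ • φ) (i k : Fin n) :
    (krylov M i *ᵥ φ) k = μ ^ (k : ℕ) * φ i :=
  congrFun (pow_mulVec_of_mulVec_eq hφ k) i

/-- The Krylov matrix sends `φ` to `φ i` times the vector of powers of `μ`. -/
lemma apply_ne_zero_of_det_krylov_ne_zero {R : Type*} [CommRing R] [IsDomain R] {n : ℕ}
    {M : Matrix (Fin n) (Fin n) R} {i : Fin n} (hdet : (krylov M i).det ≠ 0) {μ : R}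
    {φ : Fin n → R} (hφ : M *ᵥ φ = μ • φ) (hφ0 : φ ≠ 0) : φ i ≠ 0 := by
  intro hi
  refine hφ0 (eq_zero_of_mulVec_eq_zero hdet (funext fun k => ?_))
  rw [krylov_mulVec_of_mulVec_eq hφ, hi, mul_zero, Pi.zero_apply]

/-- If no eigenvector of the real symmetric matrix `M` vanishes at `i`, then the Krylov matrix of
`M` at `i` is nonsingular. -/
lemma det_krylov_ne_zero {n : ℕ} {M : Matrix (Fin n) (Fin n) ℝ} (hM : M.IsSymm) {i : Fin n}
    (h : ∀ (μ : ℝ) (φ : Fin n → ℝ), M *ᵥ φ = μ • φ → φ ≠ 0 → φ i ≠ 0) :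
    (krylov M i).det ≠ 0 := by
  have hH : M.IsHermitian := by
    rw [IsHermitian, conjTranspose_eq_transpose_of_trivial]
    exact hM
  let u : Fin n → Fin n → ℝ := fun j => ⇑(hH.eigenvectorBasis j)
  have hu : ∀ j, M *ᵥ u j = hH.eigenvalues j • u j := hH.mulVec_eigenvectorBasis
  have hlin : LinearIndependent ℝ u :=
    hH.eigenvectorBasis.toBasis.linearIndependent.map'
      (WithLp.linearEquiv 2 ℝ (Fin n → ℝ)).toLinearMap (LinearEquiv.ker _)
  have hui : ∀ j, u j i ≠ 0 := fun j => h _ _ (hu j) (hlin.ne_zero j)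
  have hinj : Function.Injective hH.eigenvalues := by
    intro j l hjl
    by_contra hne
    -- A repeated eigenvalue would allow a combination of two eigenvectors that vanishes at `i`.
    refine h (hH.eigenvalues j) (u l i • u j - u j i • u l) ?_ ?_ ?_
    · rw [mulVec_sub, mulVec_smul, mulVec_smul, hu, hu, ← hjl, smul_sub, smul_comm,
        smul_comm (u j i)]
    · intro h0
      have hpair := (LinearIndepOn.pair_iff u hne).mp (hlin.linearIndepOn _)
      exact hui l (hpair (u l i) (-u j i) (by rw [neg_smul, ← sub_eq_add_neg, h0])).1
    · simp [mul_comm]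
  have hmul : krylov M i * (of u)ᵀ =
      (vandermonde hH.eigenvalues)ᵀ * diagonal (fun j => u j i) := by
    ext k j
    rw [mul_diagonal, transpose_apply, vandermonde_apply, ← krylov_mulVec_of_mulVec_eq (hu j) i k]
    rfl
  intro h0
  have hdet := congrArg det hmul
  rw [det_mul, det_mul, h0, zero_mul, det_transpose, det_diagonal] at hdet
  exact mul_ne_zero (det_vandermonde_ne_zero_iff.mpr hinj)
    (Finset.prod_ne_zero_iff.mpr fun j _ => hui j) hdet.symm

lemma krylov_map {R S : Type*} [CommRing R] [CommRing S] (f : R →+* S) {n : ℕ}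
    (M : Matrix (Fin n) (Fin n) R) (i : Fin n) :
    (krylov M i).map f = krylov (M.map f) i := by
  ext k l
  simp only [krylov, map_apply, of_apply]
  rw [← Matrix.map_pow]
  rfl

/-- The Krylov determinant of `A + t B` is a polynomial in `t`. -/
lemma exists_eval_eq_det_krylov_family {n : ℕ} (A B : Matrix (Fin n) (Fin n) ℝ) (i : Fin n) :
    ∃ p : Polynomial ℝ, ∀ t, p.eval t = (krylov (family A B t) i).det := by
  refine ⟨(krylov (A.map Polynomial.C + (Polynomial.X : Polynomial ℝ) • B.map Polynomial.C) i).det,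
    fun t => ?_⟩
  rw [← Polynomial.coe_evalRingHom, RingHom.map_det, RingHom.mapMatrix_apply, krylov_map]
  congr 2
  ext k l
  simp [family, mul_comm t]

lemma finite_setOf_det_krylov_family_eq_zero {n : ℕ} {A B : Matrix (Fin n) (Fin n) ℝ} {i : Fin n}
    {t₀ : ℝ} (h : (krylov (family A B t₀) i).det ≠ 0) :
    {t | (krylov (family A B t) i).det = 0}.Finite := by
  obtain ⟨p, hp⟩ := exists_eval_eq_det_krylov_family A B i
  have hp0 : p ≠ 0 := by
    rintro rfl
    exact h (by rw [← hp, Polynomial.eval_zero])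
  refine p.roots.toFinset.finite_toSet.subset fun t ht => ?_
  rw [Finset.mem_coe, Multiset.mem_toFinset, Polynomial.mem_roots hp0, Polynomial.IsRoot, hp]
  exact ht

lemma mulVec_eq_of_hasEigenvector {n : ℕ} {M : Matrix (Fin n) (Fin n) ℝ} {μ : ℝ} {φ : Fin n → ℝ}
    (h : Module.End.HasEigenvector (toLin' M) μ φ) : M *ᵥ φ = μ • φ := by
  rw [← toLin'_apply, h.apply_eq_smul]

/-- Reading off one coordinate is injective on each eigenspace. -/
lemma HasNonvanishingEigenvectors.hasSimpleEigenvalues {n : ℕ} [NeZero n]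
    {M : Matrix (Fin n) (Fin n) ℝ} (h : HasNonvanishingEigenvectors M) :
    HasSimpleEigenvalues M := by
  intro μ hμ
  let f : Module.End.eigenspace (toLin' M) μ →ₗ[ℝ] ℝ :=
    LinearMap.proj (0 : Fin n) ∘ₗ Submodule.subtype _
  have hf : Function.Injective f := by
    rw [← LinearMap.ker_eq_bot, LinearMap.ker_eq_bot']
    rintro ⟨φ, hφ⟩ h0
    by_contra hne
    exact h μ φ ⟨hφ, fun h' => hne (Subtype.ext h')⟩ 0 h0
  have hle := LinearMap.finrank_le_finrank_of_injective hf
  rw [Module.finrank_self] at hle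
  have : Nontrivial (Module.End.eigenspace (toLin' M) μ) :=
    Submodule.nontrivial_iff_ne_bot.mpr hμ
  exact le_antisymm hle Module.finrank_pos

end PerturbedPair

theorem proposition2p4 {n : ℕ} (A D : Matrix (Fin n) (Fin n) ℝ)
    (hA : A.IsSymm) (hrat : ∀ i j, ∃ q : ℚ, A i j = (q : ℝ))
    (hconn : (PerturbedPair.supportGraph A hA).Connected)
    (hdiag : D.IsDiag) (hD : AlgebraicIndependent ℚ (fun i => D i i)) :
    PerturbedPair.IsGoodPair A D := by
  have hDs : D.IsSymm := hdiag.isSymm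
  have : NeZero n := ⟨by rintro rfl; exact hconn.nonempty.some.elim0⟩
  refine ⟨hA, hDs, ?_⟩
  have hdet (i : Fin n) : (PerturbedPair.krylov (PerturbedPair.family A D 1) i).det ≠ 0 := by
    rw [PerturbedPair.family, one_smul]
    exact PerturbedPair.det_krylov_ne_zero (hA.add hDs) fun μ φ hφ hφ0 =>
      PerturbedPair.apply_ne_zero_of_mulVec_eq hA hrat hconn hdiag hD hφ hφ0 i
  refine (Set.finite_iUnion fun i =>
    PerturbedPair.finite_setOf_det_krylov_family_eq_zero (hdet i)).subset fun t ht => ?_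
  by_contra hmem
  simp only [Set.mem_iUnion, Set.mem_ofPred_eq, not_exists] at hmem
  have hnv : PerturbedPair.HasNonvanishingEigenvectors (PerturbedPair.family A D t) :=
    fun μ φ hφ i => PerturbedPair.apply_ne_zero_of_det_krylov_ne_zero (hmem i)
      (PerturbedPair.mulVec_eq_of_hasEigenvector hφ) hφ.2
  exact ht ⟨hnv.hasSimpleEigenvalues, hnv⟩
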